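/- Let $\mathcal A=\{r,y,b,g\}$ be a four-letter alphabet with the discrete topology, let $\mathcal A^{\mathbb Z^2}$ carry the product topology, and let $\mathbb Z^2$ act on configurations and patches (maps $P:M\to\mathcal A$, $M\subseteq\mathbb Z^2$) by $(\gamma P)(x)=P(x-\gamma)$. A patch $P$ occurs in a patch $Q$ if some translate of $P$ is a restriction of $Q$. For $\omega\in\mathcal A^{\mathbb Z^2}$ let $W(\omega)$ be the set of finitely supported patches occurring in $\omega$, and $W(\Omega)=\bigcup_{\omega\in\Omega}W(\omega)$. A subshift is a nonempty closed translation-invariant subset of $\mathcal A^{\mathbb Z^2}$; $\overline{\mathrm{Orb}(\omega)}$ denotes the closure of $\{\gamma\omega:\gamma\in\mathbb Z^2\}$. Convergence of subshifts is convergence in the Hausdorff metric induced by a metric on $\mathcal A^{\mathbb Z^2}$ that generates the product topology. The table tiling substitution $S$ replaces the letter at position $m\in\mathbb Z^2$ by a $2\times2$ block placed on $2m+\{0,1\}^2$, according to the rule (first coordinate to the right, second coordinate upwards) \[ r\mapsto\begin{matrix}y&r\\ g&r\end{matrix},\qquad y\mapsto\begin{matrix}r&b\\ y&y\end{matrix},\qquad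 b\mapsto\begin{matrix}b&y\\ b&g\end{matrix},\qquad g\mapsto\begin{matrix}g&g\\ r&b\end{matrix}. \] Let $W(S)$ be the set of finite patches occurring in $S^n(P_c)$ for some $n\ge 0$ and $c\in\mathcal A$, where $P_c$ is the patch supported at the origin with letter $c$, and let $\Omega(S)=\{\omega\in\mathcal A^{\mathbb Z^2}: W(\omega)\subseteq W(S)\}$. Put $T=\{-1,0\}^2$. A configuration $\rho$ has a pure line defect if there is a standard basis vector $e\in\{(1,0),(0,1)\}$ of $\mathbb Z^2$ such that, for $m\in\mathbb Z^2$, $\rho|_{m+T}\notin W(\Omega(S))$ if and only if $m\in\mathbb Z e$. A finite-range Schrödinger operator is a family $H=(H_\omega)_{\omega\in\mathcal A^{\mathbb Z^2}}$ of self-adjoint operators on $\ell^2(\mathbb Z^2)$ of the form \[ (H_\omega\psi)(\gamma)=\sum_{\eta\in B}t_\eta(-\gamma\,\omega)\,\psi(\gamma+\eta), \] where $-\gamma\,\omega$ is the translate of $\omega$ by $-\gamma$, $B=-B\subseteq\mathbb Z^2$ is finite, and the functions $t_\eta:\mathcal A^{\mathbb Z^2}\to\mathbb C$ are continuous and satisfy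 $t_\eta(\omega)=\overline{t_{-\eta}(-\eta\,\omega)}$. Let $\sigma$ denote the spectrum and $\sigma_{\mathrm{ess}}$ the essential spectrum, i.e. the spectrum without the isolated eigenvalues of finite multiplicity; $\mathrm{Leb}$ is Lebesgue measure on $\mathbb R$. Fix a letter $a\in\mathcal A$, let $\omega_a$ be the constant configuration with value $a$, and put $\Theta_n=\overline{\mathrm{Orb}(S^n(\omega_a))}$. Then there exist subshifts $\Omega_0,\Omega_1$ and configurations $\rho_0\in\Omega_0$, $\rho_1\in\Omega_1$ such that the following hold. (a) For each $j\in\{0,1\}$, $\lim_{n\to\infty}\Theta_{2n+j}=\Omega_j=\overline{\mathrm{Orb}(\rho_j)}$, $S^2(\rho_j)=\rho_j$, and $\rho_j$ has a pure line defect. (b) For every finite-range Schrödinger operator $H$ there exists a finite-range Schrödinger operator $\tilde H$ such that for each $j\in\{0,1\}$ and each $\omega\in\Omega(S)$, \[ \sigma_{\mathrm{ess}}(\tilde H_{\rho_j})\neq\sigma_{\mathrm{ess}}(\tilde H_\omega)=\sigma_{\mathrm{ess}}(H_\omega). \] (c) There exists a finite-range Schrödinger operator $\hat H$ such that for each $j\in\{0,1\}$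 and each $\omega\in\Omega(S)$, \[ \mathrm{Leb}\bigl(\sigma(\hat H_{\rho_j})\setminus\sigma(\hat H_\omega)\bigr)>0. \] -/

import Mathlib

open Filter Topology MeasureTheory
open scoped ComplexConjugate

noncomputable section

namespace TableTiling

/-! ### Configurations and patches over `ℤ²` -/

/-- The group `Γ = ℤ²`. -/
abbrev Site : Type := ℤ × ℤ

/-- The alphabet `𝒜 = {r, y, b, g}`. -/
inductive Letter : Type
  | r | y | b | g
  deriving DecidableEq

instance : Fintype Letter where
  elems := {.r, .y, .b, .g}
  complete := by intro x; cases x <;> decide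

/-- The alphabet carries the discrete topology. -/
instance : TopologicalSpace Letter := ⊥

instance : DiscreteTopology Letter := ⟨rfl⟩

/-- The configuration space `𝒜^{ℤ²}`; its topology is the product topology. -/
abbrev Config : Type := Site → Letter

/-- A patch is a map `M → 𝒜` on a subset `M ⊆ ℤ²`; the value `none` marks the points outside
`M`. -/
abbrev Patch : Type := Site → Option Letter

/-- The support of a patch. -/
def supp (P : Patch) : Set Site := {x | P x ≠ none}

/-- The translation action of `ℤ²`, on configurations and on patches: `(γP)(x) = P(-γ + x)`. -/
def translate {α : Type} (γ : Site) (P : Site → α) : Site → α := fun x => P (-γ + x)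

/-- A configuration regarded as a patch with full support. -/
def Config.toPatch (ω : Config) : Patch := fun x => some (ω x)

open Classical in
/-- The restriction `ω|_M` of a configuration, a patch with support `M`. -/
def Config.restrict (ω : Config) (M : Set Site) : Patch :=
  fun x => if x ∈ M then some (ω x) else none

/-- `P` is a subpatch of `Q`: some translate of `P` agrees with the restriction of `Q` to the
support of this translate (in particular this support is contained in that of `Q`). -/
def IsSubpatch (P Q : Patch) : Prop :=
  ∃ γ : Site, ∀ x ∈ supp (translate γ P), Q x = translate γ P x

/-- The dictionary `W(ω)`: all finitely supported subpatches of `ω`. -/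
def dictionary (ω : Config) : Set Patch :=
  {P | (supp P).Finite ∧ IsSubpatch P ω.toPatch}

/-- The dictionary `W(Ω) = ⋃_{ω ∈ Ω} W(ω)`. -/
def dictionaryOf (Ω : Set Config) : Set Patch := ⋃ ω ∈ Ω, dictionary ω

/-! ### Subshifts -/

/-- A subshift is a closed, nonempty, translation invariant set of configurations. -/
structure IsSubshift (Ω : Set Config) : Prop where
  isClosed : IsClosed Ω
  nonempty : Ω.Nonempty
  invariant : ∀ γ : Site, ∀ ω ∈ Ω, translate γ ω ∈ Ω

/-- The closure of the orbit of `ω`. -/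
def orbitClosure (ω : Config) : Set Config :=
  closure (Set.range fun γ : Site => translate γ ω)

/-- Convergence of subshifts in the Hausdorff metric. The space of configurations is compact and
metrizable, and convergence does not depend on the metric inducing the product topology;
it is required here for each of them. -/
def TendstoSubshift (Θ : ℕ → Set Config) (Ω : Set Config) : Prop :=
  ∀ d : MetricSpace Config,
    d.toPseudoMetricSpace.toUniformSpace.toTopologicalSpace
        = (inferInstance : TopologicalSpace Config) →
      Tendsto (fun n => @Metric.hausdorffDist Config d.toPseudoMetricSpace (Θ n) Ω) atTop (𝓝 0)

/-! ### The table tiling substitution -/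

/-- The `2 × 2` block with upper row `p q` and lower row `s t`, on the cell `{0,1}²`
(first coordinate to the right, second coordinate upwards). -/
def block (p q s t : Letter) (f : Site) : Letter :=
  if f.2 = 1 then (if f.1 = 0 then p else q) else (if f.1 = 0 then s else t)

/-- The table tiling substitution rule `S₀ : 𝒜 → 𝒜^F` with `F = {0,1}²`. -/
def rule : Letter → Site → Letter
  | .r => block .y .r
                .g .r
  | .y => block .r .b
                .y .y
  | .b => block .b .y
                .b .g
  | .g => block .g .g
                .r .b

/-- The substitution map on patches: the letter at `m` is replaced by its block placed on
`2m + {0,1}²`. Here `/` and `%` are the integer quotient and the remainder in `{0,1}`. -/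
def substPatch (P : Patch) : Patch :=
  fun x => (P (x.1 / 2, x.2 / 2)).map fun a => rule a (x.1 % 2, x.2 % 2)

/-- The substitution map on configurations. -/
def subst (ω : Config) : Config :=
  fun x => rule (ω (x.1 / 2, x.2 / 2)) (x.1 % 2, x.2 % 2)

theorem substPatch_toPatch (ω : Config) : substPatch ω.toPatch = (subst ω).toPatch := rfl

/-- The single-letter patch `P_a` supported at the origin. -/
def letterPatch (a : Letter) : Patch := fun x => if x = 0 then some a else none

/-- The legal patches `W(S)`: finite patches occurring in some iterate `Sⁿ(P_a)`. -/
def legalPatches : Set Patch :=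
  {P | (supp P).Finite ∧ ∃ (n : ℕ) (a : Letter), IsSubpatch P (substPatch^[n] (letterPatch a))}

/-- The subshift `Ω(S)` of the substitution. -/
def substSubshift : Set Config := {ω | dictionary ω ⊆ legalPatches}

/-- The subshifts `Θ_n`, the orbit closures of `Sⁿ(ω_a)`, for the constant configuration `ω_a`. -/
def iterSubshift (a : Letter) (n : ℕ) : Set Config := orbitClosure (subst^[n] fun _ => a)

/-- The testing domain `T = {-1,0}²`. -/
def testDomain : Set Site := {-1, 0} ×ˢ {-1, 0}

/-- `ρ` has a pure line defect relative to `Ω`, with respect to `T = {-1,0}²`: for one of the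
two standard basis vectors `e`, the patch `ρ|_{m+T}` fails to be in `W(Ω)` exactly for
`m ∈ ℤ e`. -/
def HasPureLineDefect (Ω : Set Config) (ρ : Config) : Prop :=
  ∃ e : Site, (e = (1, 0) ∨ e = (0, 1)) ∧
    ∀ m : Site, ρ.restrict ((fun x => m + x) '' testDomain) ∉ dictionaryOf Ω ↔ ∃ k : ℤ, m = k • e

/-! ### Schrödinger operators of finite range -/

/-- The Hilbert space `ℓ²(ℤ²)`. -/
abbrev L2 : Type := lp (fun _ : Site => ℂ) 2

/-- The data of a Schrödinger operator of finite range: a finite symmetric set `B` and continuous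
coefficients `t_η`, `η ∈ B`, with the symmetry which makes all the operators self-adjoint.
(Values `t_η` for `η ∉ B` are irrelevant.) -/
structure FiniteRangeSchrodinger where
  B : Finset Site
  neg_mem : ∀ η ∈ B, -η ∈ B
  t : Site → Config → ℂ
  continuous_t : ∀ η ∈ B, Continuous (t η)
  symm : ∀ η ∈ B, ∀ ω, t η ω = conj (t (-η) (translate (-η) ω))

theorem memℓp_mul_shift (c : Site → ℂ) (C : ℝ) (hc : ∀ γ, ‖c γ‖ ≤ C) (η : Site) (ψ : L2) :
    Memℓp (fun γ => c γ * ψ (γ + η)) 2 := by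
  have h2 : (0 : ℝ) < (2 : ENNReal).toReal := by norm_num
  have hs : Summable fun γ => ‖ψ (γ + η)‖ ^ (2 : ENNReal).toReal :=
    ((memℓp_gen_iff h2).1 (lp.memℓp ψ)).comp_injective (add_left_injective η)
  refine (memℓp_gen_iff h2).2 (Summable.of_nonneg_of_le (fun γ => by positivity) (fun γ => ?_)
    (hs.mul_left (C ^ (2 : ENNReal).toReal)))
  have hC : 0 ≤ C := (norm_nonneg _).trans (hc 0)
  rw [norm_mul, Real.mul_rpow (norm_nonneg _) (norm_nonneg _)]
  gcongr
  exact hc γ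

theorem norm_mul_shift_le (c : Site → ℂ) (C : ℝ) (hc : ∀ γ, ‖c γ‖ ≤ C) (η : Site) (ψ : L2) :
    ‖(⟨fun γ => c γ * ψ (γ + η), memℓp_mul_shift c C hc η ψ⟩ : L2)‖ ≤ C * ‖ψ‖ := by
  have h2 : (0 : ℝ) < (2 : ENNReal).toReal := by norm_num
  have hC : 0 ≤ C := (norm_nonneg _).trans (hc 0)
  refine lp.norm_le_of_forall_sum_le h2 (by positivity) fun s => ?_
  rw [Real.mul_rpow hC (norm_nonneg _)]
  calc ∑ γ ∈ s, ‖c γ * ψ (γ + η)‖ ^ (2 : ENNReal).toReal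
      ≤ ∑ γ ∈ s, C ^ (2 : ENNReal).toReal * ‖ψ (γ + η)‖ ^ (2 : ENNReal).toReal := by
        refine Finset.sum_le_sum fun γ _ => ?_
        rw [norm_mul, Real.mul_rpow (norm_nonneg _) (norm_nonneg _)]
        gcongr
        exact hc γ
    _ = C ^ (2 : ENNReal).toReal *
          ∑ γ ∈ s.map (addRightEmbedding η), ‖ψ γ‖ ^ (2 : ENNReal).toReal := by
        rw [Finset.sum_map, Finset.mul_sum]; rfl
    _ ≤ C ^ (2 : ENNReal).toReal * ‖ψ‖ ^ (2 : ENNReal).toReal := by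
        gcongr
        exact lp.sum_rpow_le_norm_rpow h2 ψ _

namespace FiniteRangeSchrodinger

theorem exists_bound (H : FiniteRangeSchrodinger) {η : Site} (hη : η ∈ H.B) :
    ∃ C : ℝ, ∀ ω, ‖H.t η ω‖ ≤ C := by
  obtain ⟨C, hC⟩ := isCompact_univ.exists_bound_of_continuousOn (H.continuous_t η hη).continuousOn
  exact ⟨C, fun ω => hC ω (Set.mem_univ ω)⟩

/-- The summand `ψ ↦ (γ ↦ t_η(-γ ω) ψ(γ + η))` of the operator, for `η ∈ B`. -/
def term (H : FiniteRangeSchrodinger) (ω : Config) (η : {η // η ∈ H.B}) : L2 →L[ℂ] L2 :=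
  LinearMap.mkContinuous
    { toFun := fun ψ => ⟨fun γ => H.t η (translate (-γ) ω) * ψ (γ + η),
        memℓp_mul_shift _ (H.exists_bound η.2).choose
          (fun _ => (H.exists_bound η.2).choose_spec _) η ψ⟩
      map_add' := fun ψ φ => by ext γ; exact mul_add _ _ _
      map_smul' := fun a ψ => by ext γ; exact mul_left_comm _ _ _ }
    (H.exists_bound η.2).choose
    fun ψ => norm_mul_shift_le _ _ (fun _ => (H.exists_bound η.2).choose_spec _) η ψ

/-- The bounded operator `H_ω` on `ℓ²(ℤ²)`. -/
def op (H : FiniteRangeSchrodinger) (ω : Config) : L2 →L[ℂ] L2 := ∑ η ∈ H.B.attach, H.term ω η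

/-- `(H_ω ψ)(γ) = ∑_{η ∈ B} t_η(-γ ω) ψ(γ + η)`. -/
theorem op_apply (H : FiniteRangeSchrodinger) (ω : Config) (ψ : L2) (γ : Site) :
    H.op ω ψ γ = ∑ η ∈ H.B, H.t η (translate (-γ) ω) * ψ (γ + η) := by
  rw [← Finset.sum_attach]
  simp only [op, sum_apply, lp.coeFn_sum, Finset.sum_apply]
  rfl

theorem inner_term (H : FiniteRangeSchrodinger) (ω : Config) (η : {η // η ∈ H.B}) (ψ φ : L2) :
    inner ℂ (H.term ω η ψ) φ = inner ℂ ψ (H.term ω ⟨-η, H.neg_mem η η.2⟩ φ) := by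
  rw [lp.inner_eq_tsum, lp.inner_eq_tsum, ← (Equiv.addRight (-(η : Site))).tsum_eq]
  refine tsum_congr fun γ => ?_
  change φ (γ + -η) * conj (H.t η (translate (-(γ + -η)) ω) * ψ (γ + -η + η))
    = (H.t (-η) (translate (-γ) ω) * φ (γ + -η)) * conj (ψ γ)
  have h : translate (-(η : Site)) (translate (-(γ + -η)) ω) = translate (-γ) ω := by
    funext x
    simp only [translate]
    congr 1
    abel
  rw [H.symm η η.2, h, neg_add_cancel_right, map_mul, Complex.conj_conj]
  ring

/-- All the operators `H_ω` are self-adjoint. -/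
theorem isSelfAdjoint_op (H : FiniteRangeSchrodinger) (ω : Config) : IsSelfAdjoint (H.op ω) := by
  rw [ContinuousLinearMap.isSelfAdjoint_iff_isSymmetric]
  intro ψ φ
  change inner ℂ (H.op ω ψ) φ = inner ℂ ψ (H.op ω φ)
  simp only [op, sum_apply, sum_inner, inner_sum, inner_term]
  exact Finset.sum_bij' (fun η _ => ⟨-η, H.neg_mem η η.2⟩) (fun η _ => ⟨-η, H.neg_mem η η.2⟩)
    (by simp) (by simp) (by simp) (by simp) (by simp)

end FiniteRangeSchrodinger

/-! ### Spectra -/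

/-- The spectrum of a bounded self-adjoint operator, a subset of `ℝ`. -/
def spec (A : L2 →L[ℂ] L2) : Set ℝ := {x : ℝ | (x : ℂ) ∈ spectrum ℂ A}

/-- The discrete spectrum of a bounded self-adjoint operator: the eigenvalues of finite
multiplicity which are isolated points of the spectrum. -/
def discreteSpec (A : L2 →L[ℂ] L2) : Set ℝ :=
  {x ∈ spec A | (∃ ε > 0, ∀ y ∈ spec A, |y - x| < ε → y = x) ∧
    Module.End.HasEigenvalue (A : Module.End ℂ L2) (x : ℂ) ∧
    FiniteDimensional ℂ (Module.End.eigenspace (A : Module.End ℂ L2) (x : ℂ))}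

/-- The essential spectrum of a bounded self-adjoint operator: the complement of the discrete
spectrum in the spectrum. -/
def essSpec (A : L2 →L[ℂ] L2) : Set ℝ := spec A \ discreteSpec A

end TableTiling

end

noncomputable section

namespace TableTiling

/-! ### Locality and equivariance of the substitution -/

/-! Everything is read off the `2 × 2` patches on `m + T`. Substituting such a patch gives a `4 × 4`
block, whose `2 × 2` patches sit at the offsets `{-1, 0, 1}²`; every `2 × 2` patch of `S(ω)` arises
in this way. Statements about all positions thus reduce to finite tables: 24 legal patches closed
under passing to children (`child_legal`), and two families of ten illegal ones whose children
across the defect line stay in the family while all other children are legal (`child_vertical`,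
`child_horizontal`). An `S²`-fixed configuration that exhibits exactly the 24 patches shows that the
first table consists of the patches of `Ω(S)` on translates of `T`.

`S²` reproduces the constant patch around the origin, so `S²ⁿ⁺ʲ(ω_a)` converges pointwise to an
`S²`-fixed `ρ_j`. With `N = 2n + j`, the iterate is `2^N`-periodic and coincides with `ρ_j` on
`[-2^N, 2^N)²`, so both have the same small patches up to translation; this is Hausdorff convergence
of the orbit closures. The constant patch lies in one of the two illegal families, and its
illegality spreads along exactly one axis (`exists_axis`).

Legality is a local condition, so it may enter the coefficients of an operator. Isolating the
illegal sites under a potential above all norms `‖H_ω‖` leaves `Ω(S)` unaffected and creates an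
eigenvalue of infinite multiplicity on `ρ_j` (`exists_essSpec_ne`). Hopping only between illegal
sites vanishes on `Ω(S)`, but on the defect line it is free one-dimensional hopping, with `[-2, 2]`
in its spectrum (`Icc_subset_spec`). -/

theorem translate_add {α : Type} (γ γ' : Site) (P : Site → α) :
    translate γ (translate γ' P) = translate (γ + γ') P := by
  funext x
  simp only [translate]
  congr 1
  abel

theorem translate_div_two (γ x : Site) : (-γ + (x.1 / 2, x.2 / 2) : Site) =
    ((-(2 • γ) + x).1 / 2, (-(2 • γ) + x).2 / 2) := by
  ext <;> simp <;> omega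

theorem translate_mod_two (γ x : Site) : ((x.1 % 2, x.2 % 2) : Site) =
    ((-(2 • γ) + x).1 % 2, (-(2 • γ) + x).2 % 2) := by
  ext <;> simp <;> omega

theorem subst_translate (γ : Site) (ω : Config) :
    subst (translate γ ω) = translate (2 • γ) (subst ω) := by
  funext x
  simp only [subst, translate]
  rw [translate_div_two, translate_mod_two γ]

theorem substPatch_translate (γ : Site) (P : Patch) :
    substPatch (translate γ P) = translate (2 • γ) (substPatch P) := by
  funext x
  simp only [substPatch, translate]
  rw [translate_div_two, translate_mod_two γ]

theorem subst_iterate_translate (n : ℕ) (γ : Site) (ω : Config) :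
    subst^[n] (translate γ ω) = translate ((2 ^ n : ℕ) • γ) (subst^[n] ω) := by
  induction n with
  | zero => simp
  | succ n ih =>
    rw [Function.iterate_succ_apply', ih, subst_translate, Function.iterate_succ_apply', smul_smul,
      pow_succ']

/-- The square `[-k, k)²`. -/
def box (k : ℤ) : Set Site := {x | -k ≤ x.1 ∧ x.1 < k ∧ -k ≤ x.2 ∧ x.2 < k}

/-- The half-open box is what makes this exact: floor division by 2 maps `[-2k, 2k)` into `[-k, k)`.
-/
theorem eqOn_box_subst {ω ω' : Config} {k : ℤ} (h : Set.EqOn ω ω' (box k)) :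
    Set.EqOn (subst ω) (subst ω') (box (2 * k)) := by
  rintro ⟨x, y⟩ ⟨h1, h2, h3, h4⟩
  dsimp only at h1 h2 h3 h4
  simp only [subst]
  rw [h (x := (x / 2, y / 2)) ⟨by dsimp only; omega, by dsimp only; omega, by dsimp only; omega,
    by dsimp only; omega⟩]

theorem eqOn_box_iterate {ω ω' : Config} (h : Set.EqOn ω ω' (box 1)) (n : ℕ) :
    Set.EqOn (subst^[n] ω) (subst^[n] ω') (box (2 ^ n)) := by
  induction n with
  | zero => simpa using h
  | succ n ih =>
    rw [Function.iterate_succ_apply', Function.iterate_succ_apply', pow_succ']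
    exact eqOn_box_subst ih

theorem mem_box_of_le {x : Site} {n : ℕ} (h : x.1.natAbs + x.2.natAbs ≤ n) :
    x ∈ box (2 ^ n) := by
  have h1 : ((n : ℕ) : ℤ) < 2 ^ n := by exact_mod_cast Nat.lt_two_pow_self
  refine ⟨?_, ?_, ?_, ?_⟩ <;> omega

/-! ### The limit of the even iterates -/

/-- The pointwise limit of `S²ⁿ(ω)`, for a configuration `ω` which agrees with `S²(ω)` around the
origin. -/
def evenLimit (ω : Config) : Config :=
  fun x => subst^[2 * (x.1.natAbs + x.2.natAbs)] ω x

theorem iterate_even_eq {ω : Config} (h : Set.EqOn (subst^[2] ω) ω (box 1)) {x : Site} {n : ℕ}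
    (hn : x.1.natAbs + x.2.natAbs ≤ n) : subst^[2 * n] ω x = evenLimit ω x := by
  induction n, hn using Nat.le_induction with
  | base => rfl
  | succ n hn ih =>
    rw [← ih, Nat.mul_add, mul_one, Function.iterate_add_apply]
    -- `S²⁽ⁿ⁺¹⁾(ω)` is `S²ⁿ` applied to `S²(ω)`, which agrees with `ω` around the origin, and `x`
    -- already lies in the box to which `S²ⁿ` extends this agreement.
    exact eqOn_box_iterate h (2 * n) (mem_box_of_le (by omega))

theorem eventually_iterate_even_eq {ω : Config} (h : Set.EqOn (subst^[2] ω) ω (box 1)) (x : Site) :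
    ∀ᶠ n in atTop, subst^[2 * n] ω x = evenLimit ω x :=
  (eventually_ge_atTop _).mono fun _ hn => iterate_even_eq h hn

theorem eventually_subst_eq {ω : ℕ → Config} {ρ : Config} (h : ∀ x, ∀ᶠ n in atTop, ω n x = ρ x)
    (x : Site) : ∀ᶠ n in atTop, subst (ω n) x = subst ρ x :=
  (h (x.1 / 2, x.2 / 2)).mono fun n hn => by simp only [subst, hn]

theorem subst_subst_evenLimit {ω : Config} (h : Set.EqOn (subst^[2] ω) ω (box 1)) :
    subst (subst (evenLimit ω)) = evenLimit ω := by
  funext x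
  have h1 := eventually_subst_eq (eventually_subst_eq (eventually_iterate_even_eq h)) x
  have h2 := (tendsto_add_atTop_nat 1).eventually (eventually_iterate_even_eq h x)
  obtain ⟨n, hn1, hn2⟩ := (h1.and h2).exists
  rw [← hn1, ← hn2, Nat.mul_add, mul_one, Nat.add_comm, Function.iterate_add_apply]
  rfl

theorem evenLimit_eqOn {ω : Config} (h : Set.EqOn (subst^[2] ω) ω (box 1)) :
    Set.EqOn (evenLimit ω) ω (box 1) := by
  intro x hx
  obtain ⟨n, hn⟩ := (eventually_iterate_even_eq h x).exists
  rw [← hn]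
  clear hn
  induction n with
  | zero => rfl
  | succ n ih =>
    rw [← ih, Nat.mul_add, mul_one, Function.iterate_add_apply]
    have h1 : (1 : ℤ) ≤ 2 ^ (2 * n) := by exact_mod_cast Nat.one_le_two_pow
    obtain ⟨a1, a2, a3, a4⟩ := hx
    exact eqOn_box_iterate h (2 * n) ⟨by omega, by omega, by omega, by omega⟩

/-! ### Patches on the testing domain -/

/-- The letters of a patch on a translate of the testing domain, in the order lower left,
lower right, upper left, upper right. -/
abbrev Quad : Type := Letter × Letter × Letter × Letter

/-- The letters of `ω` on `m + T`. -/
def quad (ω : Config) (m : Site) : Quad :=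
  (ω (m + (-1, -1)), ω (m + (0, -1)), ω (m + (-1, 0)), ω (m + (0, 0)))

/-- The configuration which is constant on each quadrant, with the letters of `q`. -/
def quadConfig (q : Quad) : Config := fun x =>
  if x.2 < 0 then (if x.1 < 0 then q.1 else q.2.1)
  else (if x.1 < 0 then q.2.2.1 else q.2.2.2)

theorem quad_translate (γ m : Site) (ω : Config) :
    quad (translate γ ω) m = quad ω (-γ + m) := by
  simp only [quad, translate, add_assoc]

theorem mem_box_one {x : Site} :
    x ∈ box 1 ↔ x = (-1, -1) ∨ x = (0, -1) ∨ x = (-1, 0) ∨ x = (0, 0) := by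
  obtain ⟨x, y⟩ := x
  simp only [box, Set.mem_ofPred_eq, Prod.mk.injEq]
  omega

theorem testDomain_eq : testDomain = box 1 := by
  ext ⟨x, y⟩
  simp only [testDomain, box, Set.mem_prod, Set.mem_insert_iff, Set.mem_singleton_iff,
    Set.mem_ofPred_eq]
  omega

theorem quad_eq_iff {ω ω' : Config} {m m' : Site} :
    quad ω m = quad ω' m' ↔ ∀ x ∈ box 1, ω (m + x) = ω' (m' + x) := by
  simp only [mem_box_one, quad, Prod.mk.injEq]
  constructor
  · rintro ⟨h1, h2, h3, h4⟩ x (rfl | rfl | rfl | rfl) <;> assumption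
  · intro h
    exact ⟨h _ (by simp), h _ (by simp), h _ (by simp), h _ (by simp)⟩

theorem eqOn_box_one_iff {ω ω' : Config} :
    Set.EqOn ω ω' (box 1) ↔ quad ω 0 = quad ω' 0 := by
  simp [quad_eq_iff, Set.EqOn]

theorem quad_quadConfig (q : Quad) : quad (quadConfig q) 0 = q := rfl

/-- The patch on `i + T` in the substituted patch `q`; it is determined by `q` for
`i ∈ {-1, 0, 1}²`. -/
def child (q : Quad) (i : Site) : Quad := quad (subst (quadConfig q)) i

/-- The offsets `{-1, 0, 1}` in one coordinate. -/
def offsets : List ℤ := [-1, 0, 1]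

theorem mem_offsets {i : ℤ} : i ∈ offsets ↔ -1 ≤ i ∧ i ≤ 1 := by
  simp only [offsets, List.mem_cons, List.not_mem_nil, or_false]
  omega

/-- In each coordinate the letters at `m - 1` and `m` determine the positions `2m - 2, …, 2m + 1`,
which contain the window `{2m + i - 1, 2m + i}` for `|i| ≤ 1`. -/
theorem quad_subst (ω : Config) (m : Site) {i : Site} (h1 : i.1 ∈ offsets) (h2 : i.2 ∈ offsets) :
    quad (subst ω) (2 • m + i) = child (quad ω m) i := by
  have h : Set.EqOn (translate (-m) ω) (quadConfig (quad ω m)) (box 1) := by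
    rw [eqOn_box_one_iff, quad_translate, quad_quadConfig]
    simp
  have h' := eqOn_box_subst h
  rw [subst_translate] at h'
  rw [child, quad_eq_iff]
  rw [mem_offsets] at h1 h2
  rintro x ⟨a1, a2, a3, a4⟩
  rw [← h' (x := i + x) ⟨?_, ?_, ?_, ?_⟩]
  · simp only [translate]
    congr 1
    abel
  all_goals
    simp only [Prod.fst_add, Prod.snd_add]
    omega

/-- The parent position and the offset of a position, chosen by truncated division. -/
theorem exists_parent (m : Site) : ∃ m' i : Site, m = 2 • m' + i ∧ i.1 ∈ offsets ∧ i.2 ∈ offsets ∧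
    (m ≠ 0 → m'.1.natAbs + m'.2.natAbs < m.1.natAbs + m.2.natAbs) ∧
    (m.1 = 0 ↔ m'.1 = 0 ∧ i.1 = 0) ∧ (m.2 = 0 ↔ m'.2 = 0 ∧ i.2 = 0) := by
  have key : ∀ x : ℤ, ∃ y i : ℤ, x = 2 * y + i ∧ i ∈ offsets ∧ y.natAbs ≤ x.natAbs ∧
      (x ≠ 0 → y.natAbs < x.natAbs) ∧ (x = 0 ↔ y = 0 ∧ i = 0) := by
    intro x
    simp only [mem_offsets]
    -- Rounding towards zero makes the induction on `|m|` terminate; floor division would make `-1`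
    -- its own parent.
    rcases lt_or_ge x 0 with h | h
    · exact ⟨-(-x / 2), x + 2 * (-x / 2), by omega, by omega, by omega, by omega, by omega⟩
    · exact ⟨x / 2, x % 2, by omega, by omega, by omega, by omega, by omega⟩
  obtain ⟨y1, i1, a1, a2, a3, a4, a5⟩ := key m.1
  obtain ⟨y2, i2, b1, b2, b3, b4, b5⟩ := key m.2
  refine ⟨(y1, y2), (i1, i2), ?_, a2, b2, fun hm => ?_, a5, b5⟩
  · ext <;> simp [a1, b1]
  · have : m.1 ≠ 0 ∨ m.2 ≠ 0 := by
      by_contra! h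
      exact hm (Prod.ext h.1 h.2)
    dsimp only
    omega

/-! ### Legal patches on the testing domain -/

open Letter in
/-- The legal patches on the testing domain. -/
def legalQuads : List Quad :=
  [(b, g, b, y), (b, g, g, y), (b, r, g, g), (b, r, r, b), (b, y, b, g),
   (b, y, g, r), (b, y, r, b), (g, g, y, y), (g, r, y, g), (g, r, y, r),
   (g, y, y, g), (g, y, y, r), (r, b, b, g), (r, b, b, r), (r, b, g, g),
   (r, b, g, r), (r, b, r, b), (y, g, b, y), (y, g, g, y), (y, r, b, g),
   (y, r, g, r), (y, r, r, b), (y, y, b, r), (y, y, r, b)]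

open Letter in
/-- Illegal patches which occur along a vertical line. -/
def verticalDefects : List Quad :=
  [(b, b, b, b), (b, b, g, b), (g, b, y, b), (r, g, r, y), (r, r, r, g),
   (r, r, r, r), (r, y, r, g), (r, y, r, r), (y, b, b, b), (y, b, g, b)]

open Letter in
/-- Illegal patches which occur along a horizontal line. -/
def horizontalDefects : List Quad :=
  [(b, r, y, y), (b, y, y, y), (g, g, b, g), (g, g, b, r), (g, g, g, g),
   (g, g, g, r), (g, g, r, b), (r, b, y, y), (y, r, y, y), (y, y, y, y)]

theorem child_legal : ∀ q ∈ legalQuads, ∀ i ∈ offsets, ∀ j ∈ offsets,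
    child q (i, j) ∈ legalQuads := by
  decide +kernel

/-- Only the children with `i = 0` straddle the line. The others are determined by the two letters
on one side of it, and a finite check finds them legal. -/
theorem child_vertical : ∀ q ∈ verticalDefects, ∀ i ∈ offsets, ∀ j ∈ offsets,
    (i = 0 → child q (i, j) ∈ verticalDefects) ∧ (i ≠ 0 → child q (i, j) ∈ legalQuads) := by
  decide +kernel

theorem child_horizontal : ∀ q ∈ horizontalDefects, ∀ i ∈ offsets, ∀ j ∈ offsets,
    (j = 0 → child q (i, j) ∈ horizontalDefects) ∧ (j ≠ 0 → child q (i, j) ∈ legalQuads) := by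
  decide +kernel

theorem vertical_illegal : ∀ q ∈ verticalDefects, q ∉ legalQuads := by decide +kernel

theorem horizontal_illegal : ∀ q ∈ horizontalDefects, q ∉ legalQuads := by decide +kernel

theorem quad_subst_legal {ω : Config} (h : ∀ m, quad ω m ∈ legalQuads) (m : Site) :
    quad (subst ω) m ∈ legalQuads := by
  obtain ⟨m', i, rfl, h1, h2, -⟩ := exists_parent m
  rw [quad_subst _ _ h1 h2]
  exact child_legal _ (h m') _ h1 _ h2

/-- A property of patches and positions which passes from parents to children passes from the
origin to all positions, for two configurations which are substituted to each other. -/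
theorem quad_induction {ρ ρ' : Config} (h : subst ρ = ρ') (h' : subst ρ' = ρ)
    {p : Quad → Site → Prop} (h0 : p (quad ρ 0) 0) (h0' : p (quad ρ' 0) 0)
    (step : ∀ q m i, i.1 ∈ offsets → i.2 ∈ offsets →
      ((2 • m + i).1 = 0 ↔ m.1 = 0 ∧ i.1 = 0) → ((2 • m + i).2 = 0 ↔ m.2 = 0 ∧ i.2 = 0) →
      p q m → p (child q i) (2 • m + i)) (m : Site) :
    p (quad ρ m) m ∧ p (quad ρ' m) m := by
  induction hn : m.1.natAbs + m.2.natAbs using Nat.strong_induction_on generalizing m with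
  | _ n ih =>
    by_cases hm : m = 0
    · rw [hm]
      exact ⟨h0, h0'⟩
    obtain ⟨m', i, rfl, h1, h2, h3, h4, h5⟩ := exists_parent m
    obtain ⟨a, b⟩ := ih _ (hn ▸ h3 hm) m' rfl
    constructor
    · rw [← h', quad_subst _ _ h1 h2]
      exact step _ _ _ h1 h2 h4 h5 b
    · rw [← h, quad_subst _ _ h1 h2]
      exact step _ _ _ h1 h2 h4 h5 a

/-- A position has first coordinate 0 exactly when its parent and its offset do. Hence the dichotomy
of `child_vertical`, together with `child_legal` off the line, propagates from the origin to the
whole plane. -/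
theorem quad_legal_iff_of_vertical {ρ ρ' : Config} (h : subst ρ = ρ') (h' : subst ρ' = ρ)
    (h0 : quad ρ 0 ∈ verticalDefects) (m : Site) :
    (quad ρ m ∈ legalQuads ↔ m.1 ≠ 0) ∧ (quad ρ' m ∈ legalQuads ↔ m.1 ≠ 0) := by
  have h0' : quad ρ' 0 ∈ verticalDefects := by
    have h2 := quad_subst ρ 0 (i := (0, 0)) (by decide) (by decide)
    rw [h, show (2 • (0 : Site) + (0, 0)) = 0 from rfl] at h2
    rw [h2]
    exact (child_vertical _ h0 0 (by decide) 0 (by decide)).1 rfl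
  have key := quad_induction h h'
    (p := fun q m => (m.1 = 0 → q ∈ verticalDefects) ∧ (m.1 ≠ 0 → q ∈ legalQuads))
    ⟨fun _ => h0, fun h => (h rfl).elim⟩ ⟨fun _ => h0', fun h => (h rfl).elim⟩
    (fun q m i h1 h2 h3 _ hq => by
      by_cases hm : m.1 = 0
      · have := child_vertical q (hq.1 hm) i.1 h1 i.2 h2
        exact ⟨fun h => this.1 (h3.1 h).2, fun h => this.2 fun h' => h (h3.2 ⟨hm, h'⟩)⟩
      · have := child_legal q (hq.2 hm) i.1 h1 i.2 h2
        exact ⟨fun h => (hm (h3.1 h).1).elim, fun _ => this⟩) m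
  exact ⟨⟨fun hl h => vertical_illegal _ (key.1.1 h) hl, key.1.2⟩,
    ⟨fun hl h => vertical_illegal _ (key.2.1 h) hl, key.2.2⟩⟩

theorem quad_legal_iff_of_horizontal {ρ ρ' : Config} (h : subst ρ = ρ') (h' : subst ρ' = ρ)
    (h0 : quad ρ 0 ∈ horizontalDefects) (m : Site) :
    (quad ρ m ∈ legalQuads ↔ m.2 ≠ 0) ∧ (quad ρ' m ∈ legalQuads ↔ m.2 ≠ 0) := by
  have h0' : quad ρ' 0 ∈ horizontalDefects := by
    have h2 := quad_subst ρ 0 (i := (0, 0)) (by decide) (by decide)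
    rw [h, show (2 • (0 : Site) + (0, 0)) = 0 from rfl] at h2
    rw [h2]
    exact (child_horizontal _ h0 0 (by decide) 0 (by decide)).1 rfl
  have key := quad_induction h h'
    (p := fun q m => (m.2 = 0 → q ∈ horizontalDefects) ∧ (m.2 ≠ 0 → q ∈ legalQuads))
    ⟨fun _ => h0, fun h => (h rfl).elim⟩ ⟨fun _ => h0', fun h => (h rfl).elim⟩
    (fun q m i h1 h2 _ h3 hq => by
      by_cases hm : m.2 = 0
      · have := child_horizontal q (hq.1 hm) i.1 h1 i.2 h2
        exact ⟨fun h => this.1 (h3.1 h).2, fun h => this.2 fun h' => h (h3.2 ⟨hm, h'⟩)⟩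
      · have := child_legal q (hq.2 hm) i.1 h1 i.2 h2
        exact ⟨fun h => (hm (h3.1 h).1).elim, fun _ => this⟩) m
  exact ⟨⟨fun hl h => horizontal_illegal _ (key.1.1 h) hl, key.1.2⟩,
    ⟨fun hl h => horizontal_illegal _ (key.2.1 h) hl, key.2.2⟩⟩

/-! ### A periodic point of the substitution in the substitution subshift -/

/-- The central patch of the periodic point. -/
def seedQuad : Quad := (.r, .b, .r, .b)

/-- A periodic point of the substitution, all of whose patches are legal. -/
def periodicPoint : Config := evenLimit (quadConfig seedQuad)

theorem eqOn_seedQuad_two :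
    Set.EqOn (subst^[2] (quadConfig seedQuad)) (quadConfig seedQuad) (box 1) := by
  rw [eqOn_box_one_iff]
  decide +kernel

theorem quad_periodicPoint_zero : quad periodicPoint 0 = seedQuad :=
  eqOn_box_one_iff.1 (evenLimit_eqOn eqOn_seedQuad_two)

theorem subst_subst_periodicPoint : subst (subst periodicPoint) = periodicPoint :=
  subst_subst_evenLimit eqOn_seedQuad_two

theorem quad_periodicPoint_legal (m : Site) : quad periodicPoint m ∈ legalQuads := by
  have h : quad (subst periodicPoint) 0 ∈ legalQuads := by
    have h2 := quad_subst periodicPoint 0 (i := (0, 0)) (by decide) (by decide)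
    rw [show (2 • (0 : Site) + (0, 0)) = 0 from rfl, quad_periodicPoint_zero] at h2
    rw [h2]
    decide +kernel
  exact (quad_induction (ρ := periodicPoint) rfl subst_subst_periodicPoint
    (p := fun q _ => q ∈ legalQuads) (by rw [quad_periodicPoint_zero]; decide +kernel) h
    (fun q _ i h1 h2 _ _ hq => child_legal q hq _ h1 _ h2) m).1

/-- The children of a list of patches. -/
def children (l : List Quad) : List Quad :=
  (l.flatMap fun q => offsets.flatMap fun i => offsets.map fun j => child q (i, j)).dedup

theorem mem_children {l : List Quad} {ω : Config} (h : ∀ q ∈ l, ∃ m, quad ω m = q) :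
    ∀ q ∈ children l, ∃ m, quad (subst ω) m = q := by
  intro q hq
  simp only [children, List.mem_dedup, List.mem_flatMap, List.mem_map] at hq
  obtain ⟨p, hp, i, hi, j, hj, rfl⟩ := hq
  obtain ⟨m, rfl⟩ := h p hp
  exact ⟨_, quad_subst ω m (i := (i, j)) hi hj⟩

theorem exists_quad_periodicPoint {q : Quad} (hq : q ∈ legalQuads) : ∃ m, quad periodicPoint m = q := by
  have h0 : ∀ q ∈ [seedQuad], ∃ m, quad periodicPoint m = q := by
    exact fun q hq => ⟨0, by rw [quad_periodicPoint_zero, List.mem_singleton.1 hq]⟩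
  -- Four generations of children of the seed exhaust the list, and being an even number they lead
  -- back to `periodicPoint`.
  have h4 := mem_children (mem_children (mem_children (mem_children h0)))
  rw [subst_subst_periodicPoint, subst_subst_periodicPoint] at h4
  have hl : ∀ q ∈ legalQuads, q ∈ children (children (children (children [seedQuad]))) := by
    decide +kernel
  exact h4 q (hl q hq)

/-! ### The dictionary of the substitution subshift -/

theorem substPatch_le {P : Patch} {ω : Config} (h : ∀ x ∈ supp P, P x = some (ω x)) :
    ∀ x ∈ supp (substPatch P), substPatch P x = some (subst ω x) := by
  intro x hx
  have hP : (x.1 / 2, x.2 / 2) ∈ supp P := by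
    intro h0
    apply hx
    simp only [substPatch, h0, Option.map_none]
  simp only [substPatch, h _ hP, Option.map_some, subst]

theorem substPatch_iterate_le {P : Patch} {ω : Config} (h : ∀ x ∈ supp P, P x = some (ω x))
    (n : ℕ) : ∀ x ∈ supp (substPatch^[n] P), substPatch^[n] P x = some (subst^[n] ω x) := by
  induction n with
  | zero => exact h
  | succ n ih =>
    rw [Function.iterate_succ_apply', Function.iterate_succ_apply']
    exact substPatch_le ih

theorem quad_subst_iterate_legal {ω : Config} (h : ∀ m, quad ω m ∈ legalQuads) (n : ℕ) (m : Site) :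
    quad (subst^[n] ω) m ∈ legalQuads := by
  induction n generalizing m with
  | zero => exact h m
  | succ n ih =>
    rw [Function.iterate_succ_apply']
    exact quad_subst_legal ih m

theorem exists_periodicPoint_eq (a : Letter) : ∃ m, periodicPoint m = a := by
  have h : ∀ a : Letter, ∃ q ∈ legalQuads, q.2.2.2 = a := by decide +kernel
  obtain ⟨q, hq, rfl⟩ := h a
  obtain ⟨m, rfl⟩ := exists_quad_periodicPoint hq
  exact ⟨m + (0, 0), rfl⟩

/-- The restriction of `ω` to `m + T`. -/
abbrev testPatch (ω : Config) (m : Site) : Patch :=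
  ω.restrict ((fun x => m + x) '' testDomain)

theorem testPatch_add {ω : Config} {m x : Site} (hx : x ∈ box 1) :
    testPatch ω m (m + x) = some (ω (m + x)) := by
  rw [testPatch, Config.restrict, if_pos ⟨x, testDomain_eq ▸ hx, rfl⟩]

theorem exists_of_mem_supp_testPatch {ω : Config} {m x : Site} (hx : x ∈ supp (testPatch ω m)) :
    ∃ y ∈ box 1, x = m + y := by
  by_contra! h
  apply hx
  rw [testPatch, Config.restrict, if_neg]
  rintro ⟨y, hy, rfl⟩
  exact h y (testDomain_eq ▸ hy) rfl

/-- The letter `a` occurs in `periodicPoint`, so `Sⁿ(P_a)` is part of `Sⁿ` of a translate of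
`periodicPoint`, where all patches are legal. -/
theorem quad_legal_of_testPatch {ω : Config} {m : Site} (h : testPatch ω m ∈ legalPatches) :
    quad ω m ∈ legalQuads := by
  obtain ⟨-, n, a, γ, hγ⟩ := h
  obtain ⟨p, hp⟩ := exists_periodicPoint_eq a
  have hle : ∀ x ∈ supp (letterPatch a),
      letterPatch a x = some (translate (-p) periodicPoint x) := by
    intro x hx
    have h0 : x = 0 := by
      by_contra h0
      exact hx (if_neg h0)
    rw [h0, letterPatch, if_pos rfl, translate, neg_neg, add_zero, hp]
  have h1 := substPatch_iterate_le hle n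
  have h2 : quad ω m = quad (subst^[n] (translate (-p) periodicPoint)) (γ + m) := by
    rw [quad_eq_iff]
    intro x hx
    have h3 : translate γ (testPatch ω m) (γ + m + x) = some (ω (m + x)) := by
      rw [← testPatch_add hx, translate]
      congr 1
      abel
    have h4 := hγ (γ + m + x) (by
      show _ ≠ none
      rw [h3]
      exact Option.some_ne_none _)
    rw [h3] at h4
    have h5 := h1 (γ + m + x) (by
      show _ ≠ none
      rw [h4]
      exact Option.some_ne_none _)
    rw [h4] at h5
    exact Option.some_injective _ h5
  rw [h2]
  refine quad_subst_iterate_legal (fun m => ?_) _ _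
  rw [quad_translate]
  exact quad_periodicPoint_legal _

theorem finite_box (k : ℤ) : (box k).Finite := by
  refine ((Set.finite_Ico (-k) k).prod (Set.finite_Ico (-k) k)).subset ?_
  rintro x ⟨h1, h2, h3, h4⟩
  exact ⟨⟨h1, h2⟩, h3, h4⟩

theorem finite_supp_testPatch (ω : Config) (m : Site) : (supp (testPatch ω m)).Finite :=
  ((finite_box 1).image fun y => m + y).subset fun x hx => by
    obtain ⟨y, hy, rfl⟩ := exists_of_mem_supp_testPatch hx
    exact ⟨y, hy, rfl⟩

theorem testPatch_mem_dictionary {ω ω' : Config} {m m' : Site} (h : quad ω m = quad ω' m') :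
    testPatch ω m ∈ dictionary ω' := by
  refine ⟨finite_supp_testPatch ω m, m' - m, fun x hx => ?_⟩
  obtain ⟨y, hy, hxy⟩ := exists_of_mem_supp_testPatch hx
  have hx' : x = m' + y := by
    rw [← add_right_inj (-(m' - m)), hxy]
    abel
  rw [show translate (m' - m) (testPatch ω m) x = _ from congrArg (testPatch ω m) hxy,
    testPatch_add hy, quad_eq_iff.1 h y hy, Config.toPatch, hx']

theorem quad_legal_of_mem_substSubshift {ω : Config} (h : ω ∈ substSubshift) (m : Site) :
    quad ω m ∈ legalQuads :=
  quad_legal_of_testPatch (h (testPatch_mem_dictionary rfl))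

theorem subst_iterate_two_mul {ρ : Config} (h : subst (subst ρ) = ρ) (n : ℕ) :
    subst^[2 * n] ρ = ρ := by
  rw [Function.iterate_mul]
  exact Function.iterate_fixed h n

theorem exists_seedQuad_legal : ∃ p : Site, ∀ x ∈ box 1,
    substPatch^[2] (letterPatch .y) (p + x) = some (quadConfig seedQuad x) := by
  refine ⟨(2, 3), fun x hx => ?_⟩
  rcases mem_box_one.1 hx with rfl | rfl | rfl | rfl <;> decide +kernel

theorem substPatch_iterate_eq {P : Patch} {ω : Config}
    (h : ∀ x ∈ box 1, P x = some (ω x)) (n : ℕ) :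
    ∀ x ∈ box (2 ^ n), substPatch^[n] P x = some (subst^[n] ω x) := by
  induction n with
  | zero => simpa using h
  | succ n ih =>
    rintro ⟨x, y⟩ ⟨h1, h2, h3, h4⟩
    rw [pow_succ'] at h1 h2 h3 h4
    rw [Function.iterate_succ_apply', Function.iterate_succ_apply']
    dsimp only at h1 h2 h3 h4
    simp only [substPatch, subst]
    rw [ih (x / 2, y / 2) ⟨by dsimp only; omega, by dsimp only; omega, by dsimp only; omega,
      by dsimp only; omega⟩, Option.map_some]

theorem substPatch_iterate_translate (n : ℕ) (γ : Site) (P : Patch) :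
    substPatch^[n] (translate γ P) = translate ((2 ^ n : ℕ) • γ) (substPatch^[n] P) := by
  induction n with
  | zero => simp
  | succ n ih =>
    rw [Function.iterate_succ_apply', ih, substPatch_translate, Function.iterate_succ_apply',
      smul_smul, pow_succ']

theorem eventually_subset_box {s : Set Site} (hs : s.Finite) :
    ∀ᶠ n : ℕ in atTop, s ⊆ box (2 ^ n) := by
  obtain ⟨N, hN⟩ := (hs.image fun x : Site => x.1.natAbs + x.2.natAbs).bddAbove
  filter_upwards [eventually_ge_atTop N] with n hn x hx
  exact mem_box_of_le ((hN ⟨x, hx, rfl⟩).trans hn)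

theorem tendsto_two_mul_atTop : Tendsto (fun n : ℕ => 2 * n) atTop atTop :=
  tendsto_id.const_mul_atTop' two_pos

theorem finite_supp_translate {P : Patch} (h : (supp P).Finite) (γ : Site) :
    (supp (translate γ P)).Finite :=
  (h.image fun x => γ + x).subset fun x hx => ⟨-γ + x, hx, add_neg_cancel_left γ x⟩

/-- The seed occurs in `S²(P_y)`. Hence `S²ⁿ⁺²(P_y)` contains a copy of the box `[-4ⁿ, 4ⁿ)²` of the
fixed point, and any finite patch fits into such a box after a translation. -/
theorem periodicPoint_mem_substSubshift : periodicPoint ∈ substSubshift := by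
  rintro P ⟨hfin, γ, hγ⟩
  refine ⟨hfin, ?_⟩
  obtain ⟨n, hn⟩ := (tendsto_two_mul_atTop.eventually
    (eventually_subset_box (finite_supp_translate hfin γ))).exists
  obtain ⟨p, hp⟩ := exists_seedQuad_legal
  refine ⟨2 * n + 2, .y, (2 ^ (2 * n) : ℕ) • p + γ, fun x hx => ?_⟩
  have key := substPatch_iterate_eq (P := translate (-p) (substPatch^[2] (letterPatch .y)))
    (ω := periodicPoint) (fun x hx => by
      have h0 : periodicPoint x = quadConfig seedQuad x :=
        eqOn_box_one_iff.2 quad_periodicPoint_zero hx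
      rw [translate, neg_neg, hp x hx, h0]) (2 * n)
  rw [← translate_add] at hx ⊢
  have hx' : -((2 ^ (2 * n) : ℕ) • p) + x ∈ supp (translate γ P) := hx
  have h1 := key _ (hn hx')
  rw [substPatch_iterate_translate, subst_iterate_two_mul subst_subst_periodicPoint] at h1
  rw [Function.iterate_add_apply]
  calc _ = _ := by
        rw [translate, smul_neg, neg_neg, add_neg_cancel_left] at h1
        exact h1
    _ = _ := hγ _ hx'

/-- This turns the line defect, defined through the dictionary of `Ω(S)`, into a condition on a
finite list. -/
theorem testPatch_mem_dictionaryOf_iff {ω : Config} {m : Site} :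
    testPatch ω m ∈ dictionaryOf substSubshift ↔ quad ω m ∈ legalQuads := by
  constructor
  · intro h
    simp only [dictionaryOf, Set.mem_iUnion] at h
    obtain ⟨ω', hω', h⟩ := h
    exact quad_legal_of_testPatch (hω' h)
  · intro h
    obtain ⟨m', hm'⟩ := exists_quad_periodicPoint h
    exact Set.mem_biUnion periodicPoint_mem_substSubshift (testPatch_mem_dictionary hm'.symm)

/-! ### Hausdorff convergence of orbit closures -/

/-- A Lebesgue number argument: each configuration has a window controlling distances to it, and
compactness makes finitely many of these windows suffice, for any metric inducing the topology. -/
theorem exists_window (d : MetricSpace Config)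
    (hd : d.toPseudoMetricSpace.toUniformSpace.toTopologicalSpace = Pi.topologicalSpace) {ε : ℝ} (hε : 0 < ε) :
    ∃ W : Finset Site, ∀ ω ω' : Config, (∀ x ∈ W, ω x = ω' x) →
      @dist Config d.toDist ω ω' < ε := by
  have hball : ∀ ω : Config, ∃ W : Finset Site, ∀ ω' : Config, (∀ x ∈ W, ω' x = ω x) →
      @dist Config d.toDist ω' ω < ε / 2 := by
    intro ω
    have h1 : {ω' | @dist Config d.toDist ω' ω < ε / 2} ∈ 𝓝 ω := by
      rw [← hd]
      exact @Metric.ball_mem_nhds Config d.toPseudoMetricSpace ω _ (half_pos hε)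
    rw [nhds_pi, Filter.mem_pi'] at h1
    obtain ⟨W, t, ht, hsub⟩ := h1
    exact ⟨W, fun ω' h => hsub fun x hx => by rw [h x hx]; exact mem_of_mem_nhds (ht x)⟩
  choose W hW using hball
  have hnhds : ∀ ω : Config, {ω' : Config | ∀ x ∈ W ω, ω' x = ω x} ∈ 𝓝 ω := by
    intro ω
    refine (Finset.eventually_all (W ω)).2 fun x _ => ?_
    exact (continuous_apply x).continuousAt.eventually
      (show ∀ᶠ a in 𝓝 (ω x), a = ω x by rw [nhds_discrete]; simp)
  obtain ⟨s, -, hs⟩ := isCompact_univ.elim_nhds_subcover _ fun ω _ => hnhds ω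
  classical
  refine ⟨s.biUnion W, fun ω ω' h => ?_⟩
  have hω := hs (Set.mem_univ ω)
  simp only [Set.mem_iUnion] at hω
  obtain ⟨τ, hτ, hω⟩ := hω
  have h1 := hW τ ω hω
  have h2 := hW τ ω' fun x hx => by
    rw [← h x (Finset.mem_biUnion.2 ⟨τ, hτ, hx⟩)]
    exact hω x hx
  have h3 := @dist_triangle_right Config d.toPseudoMetricSpace ω ω' τ
  linarith

/-- Orbit closures converge if, on each finite window, every translate of one configuration agrees
eventually with a translate of the other. -/
theorem tendstoSubshift_orbitClosure {ω : ℕ → Config} {ρ : Config}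
    (h : ∀ W : Finset Site, ∀ᶠ n in atTop,
      (∀ γ, ∃ γ', ∀ x ∈ W, translate γ (ω n) x = translate γ' ρ x) ∧
      (∀ γ, ∃ γ', ∀ x ∈ W, translate γ ρ x = translate γ' (ω n) x)) :
    TendstoSubshift (fun n => orbitClosure (ω n)) (orbitClosure ρ) := by
  intro d hd
  rw [@Metric.tendsto_atTop]
  intro ε hε
  obtain ⟨W, hW⟩ := exists_window d hd (half_pos hε)
  obtain ⟨N, hN⟩ := eventually_atTop.1 (h W)
  refine ⟨N, fun n hn => ?_⟩
  obtain ⟨h1, h2⟩ := hN n hn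
  have h0 := @Metric.hausdorffDist_nonneg Config d.toPseudoMetricSpace
  rw [Real.dist_eq, sub_zero, abs_of_nonneg h0]
  have hcl : ∀ τ : Config, orbitClosure τ =
      @closure Config d.toPseudoMetricSpace.toUniformSpace.toTopologicalSpace
        (Set.range fun γ => translate γ τ) := by
    intro τ
    rw [hd]
    rfl
  beta_reduce
  -- The Hausdorff distance does not see closures, so it is enough to compare the orbits themselves.
  rw [hcl, hcl, @Metric.hausdorffDist_closure]
  refine lt_of_le_of_lt (@Metric.hausdorffDist_le_of_mem_dist Config d.toPseudoMetricSpace _ _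
    (ε / 2) (half_pos hε).le ?_ ?_) (half_lt_self hε)
  · rintro _ ⟨γ, rfl⟩
    obtain ⟨γ', hγ'⟩ := h1 γ
    exact ⟨_, ⟨γ', rfl⟩, (hW _ _ hγ').le⟩
  · rintro _ ⟨γ, rfl⟩
    obtain ⟨γ', hγ'⟩ := h2 γ
    exact ⟨_, ⟨γ', rfl⟩, (hW _ _ hγ').le⟩

/-- Pointwise convergence gives, on each finite window, all translates of the limit. -/
theorem eventually_exists_translate {ω : ℕ → Config} {ρ : Config}
    (h : ∀ x, ∀ᶠ n in atTop, ω n x = ρ x) (W : Finset Site) :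
    ∀ᶠ n in atTop, ∀ γ, ∃ γ', ∀ x ∈ W, translate γ ρ x = translate γ' (ω n) x := by
  -- Only finitely many patterns occur on `W`. One representative translate for each reduces the
  -- claim to pointwise convergence at finitely many sites.
  let f : Site → (W → Letter) := fun γ x => translate γ ρ x
  have hf : ∀ p : Set.range f, ∃ γ, f γ = p := fun p => p.2
  choose g hg using hf
  have h1 : ∀ᶠ n in atTop, ∀ p : Set.range f, ∀ x : W, ω n (-g p + x) = ρ (-g p + x) :=
    eventually_all.2 fun p => eventually_all.2 fun x => h _
  filter_upwards [h1] with n hn γ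
  refine ⟨g ⟨f γ, γ, rfl⟩, fun x hx => ?_⟩
  have h2 := congrFun (hg ⟨f γ, γ, rfl⟩) ⟨x, hx⟩
  exact h2.symm.trans (hn _ ⟨x, hx⟩).symm

theorem isSubshift_orbitClosure (ω : Config) : IsSubshift (orbitClosure ω) where
  isClosed := isClosed_closure
  nonempty := ⟨ω, subset_closure ⟨0, by funext x; simp [translate]⟩⟩
  invariant γ τ hτ := by
    have hc : Continuous (translate γ : Config → Config) :=
      continuous_pi fun x => continuous_apply _
    refine map_mem_closure hc hτ ?_
    rintro _ ⟨γ', rfl⟩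
    exact ⟨γ + γ', (translate_add γ γ' ω).symm⟩

theorem mem_orbitClosure_self (ω : Config) : ω ∈ orbitClosure ω :=
  subset_closure ⟨0, by funext x; simp [translate]⟩

/-! ### The limits of the iterates of a constant configuration -/

theorem eqOn_constant (a : Letter) :
    Set.EqOn (subst^[2] fun _ => a) (fun _ => a) (box 1) := by
  rw [eqOn_box_one_iff]
  revert a
  decide +kernel

/-- The limit of the iterates `S²ⁿ⁺ʲ(ω_a)`. -/
def limitConfig (a : Letter) (j : ℕ) : Config := subst^[j] (evenLimit fun _ => a)

theorem limitConfig_add_two (a : Letter) (j : ℕ) : limitConfig a (j + 2) = limitConfig a j :=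
  congrArg subst^[j] (subst_subst_evenLimit (eqOn_constant a))

theorem subst_subst_limitConfig (a : Letter) (j : ℕ) :
    subst (subst (limitConfig a j)) = limitConfig a j := by
  conv_rhs => rw [← limitConfig_add_two]
  simp only [limitConfig, Function.iterate_succ_apply']

theorem eventually_iterate_eq_limitConfig (a : Letter) (j : ℕ) :
    ∀ x, ∀ᶠ n in atTop, (subst^[2 * n + j] fun _ => a) x = limitConfig a j x := by
  simp only [limitConfig]
  induction j with
  | zero => exact eventually_iterate_even_eq (eqOn_constant a)
  | succ j ih =>
    simp only [← add_assoc, Function.iterate_succ_apply']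
    exact eventually_subst_eq ih

/-- The limit equals `S²ⁿ⁺ʲ(evenLimit)`, and `evenLimit` agrees with the constant configuration on
`[-1, 1)²`. -/
theorem limitConfig_eqOn_box (a : Letter) (j n : ℕ) :
    Set.EqOn (limitConfig a j) (subst^[2 * n + j] fun _ => a) (box (2 ^ (2 * n + j))) := by
  have h := eqOn_box_iterate (evenLimit_eqOn (eqOn_constant a)) (2 * n + j)
  rwa [Nat.add_comm (2 * n) j, Function.iterate_add_apply,
    subst_iterate_two_mul (subst_subst_evenLimit (eqOn_constant a)), Nat.add_comm j] at h

theorem exists_nearest_multiple {k : ℤ} (hk : 0 < k) (x : ℤ) :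
    ∃ p : ℤ, -k ≤ 2 * (x - k * p) ∧ 2 * (x - k * p) < k := by
  refine ⟨(2 * x + k) / (2 * k), ?_, ?_⟩
  · nlinarith [Int.mul_ediv_self_le (x := 2 * x + k) (k := 2 * k) (by omega)]
  · nlinarith [Int.lt_mul_ediv_self_add (x := 2 * x + k) (k := 2 * k) (by omega)]

/-- By `2^N`-periodicity of the iterate, the translation vector may be reduced to coordinates of
size at most `2^N / 2`. The window takes up the other half of the box, whence the factor 2 in `hW`.
-/
theorem exists_translate_limitConfig (a : Letter) (j n : ℕ) {W : Set Site}
    (hW : ∀ x ∈ W, 2 • x ∈ box (2 ^ (2 * n + j))) (γ : Site) :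
    ∃ γ', ∀ x ∈ W, translate γ (subst^[2 * n + j] fun _ => a) x =
      translate γ' (limitConfig a j) x := by
  set N := 2 * n + j with hN
  have hk : (0 : ℤ) < 2 ^ N := by positivity
  obtain ⟨p1, h1, h2⟩ := exists_nearest_multiple hk (-γ.1)
  obtain ⟨p2, h3, h4⟩ := exists_nearest_multiple hk (-γ.2)
  refine ⟨γ + (2 ^ N : ℕ) • (p1, p2), fun x hx => ?_⟩
  have hbox : -(γ + (2 ^ N : ℕ) • (p1, p2)) + x ∈ box (2 ^ N) := by
    obtain ⟨a1, a2, a3, a4⟩ := hW x hx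
    simp only [nsmul_eq_mul, Prod.fst_mul, Prod.snd_mul] at a1 a2 a3 a4
    refine ⟨?_, ?_, ?_, ?_⟩ <;> simp at * <;> linarith
  rw [translate, translate, limitConfig_eqOn_box a j n hbox, ← hN]
  have hper := subst_iterate_translate N (p1, p2) fun _ => a
  have hc : translate (p1, p2) (fun _ => a : Config) = fun _ => a := rfl
  rw [hc] at hper
  conv_lhs => rw [hper]
  rw [translate]
  refine congrArg (subst^[N] fun _ => a) ?_
  abel

theorem tendstoSubshift_limitConfig (a : Letter) (j : ℕ) :
    TendstoSubshift (fun n => iterSubshift a (2 * n + j)) (orbitClosure (limitConfig a j)) := by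
  refine tendstoSubshift_orbitClosure fun W => ?_
  have h := (tendsto_atTop_mono (fun n => Nat.le_add_right _ j) tendsto_two_mul_atTop).eventually
    (eventually_subset_box (W.finite_toSet.image fun x => 2 • x))
  filter_upwards [eventually_exists_translate (eventually_iterate_eq_limitConfig a j) W,
    h] with n h1 h2
  exact ⟨exists_translate_limitConfig a j n fun x hx => h2 ⟨x, hx, rfl⟩, h1⟩

/-! ### The line defect -/

theorem quad_limitConfig_zero (a : Letter) : quad (limitConfig a 0) 0 = (a, a, a, a) :=
  eqOn_box_one_iff.1 (evenLimit_eqOn (eqOn_constant a))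

/-- The limits have illegal patches exactly along a coordinate axis. -/
theorem exists_axis (a : Letter) (j : Fin 2) : ∃ e : Site, (e = (1, 0) ∨ e = (0, 1)) ∧
    ∀ m, quad (limitConfig a j) m ∉ legalQuads ↔ ∃ k : ℤ, m = k • e := by
  have h01 : subst (limitConfig a 0) = limitConfig a 1 := rfl
  have h10 : subst (limitConfig a 1) = limitConfig a 0 := subst_subst_limitConfig a 0
  have hcases : ∀ a : Letter,
      (a, a, a, a) ∈ verticalDefects ∨ (a, a, a, a) ∈ horizontalDefects := by decide +kernel
  rcases hcases a with h | h <;> rw [← quad_limitConfig_zero] at h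
  · refine ⟨(0, 1), Or.inr rfl, fun m => ?_⟩
    have key : quad (limitConfig a j) m ∈ legalQuads ↔ m.1 ≠ 0 := by
      fin_cases j
      · exact (quad_legal_iff_of_vertical h01 h10 h m).1
      · exact (quad_legal_iff_of_vertical h01 h10 h m).2
    rw [key, not_not]
    constructor
    · intro h0
      exact ⟨m.2, Prod.ext (by simpa using h0) (by simp)⟩
    · rintro ⟨k, rfl⟩
      simp
  · refine ⟨(1, 0), Or.inl rfl, fun m => ?_⟩
    have key : quad (limitConfig a j) m ∈ legalQuads ↔ m.2 ≠ 0 := by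
      fin_cases j
      · exact (quad_legal_iff_of_horizontal h01 h10 h m).1
      · exact (quad_legal_iff_of_horizontal h01 h10 h m).2
    rw [key, not_not]
    constructor
    · intro h0
      exact ⟨m.1, Prod.ext (by simp) (by simpa using h0)⟩
    · rintro ⟨k, rfl⟩
      simp

theorem hasPureLineDefect_limitConfig (a : Letter) (j : Fin 2) :
    HasPureLineDefect substSubshift (limitConfig a j) := by
  obtain ⟨e, he, h⟩ := exists_axis a j
  refine ⟨e, he, fun m => ?_⟩
  rw [← h m]
  exact not_congr testPatch_mem_dictionaryOf_iff

/-! ### Operators on `ℓ²(ℤ²)` -/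

/-- The unit vector at a site. -/
def delta (m : Site) : L2 := lp.single 2 m 1

theorem delta_apply (m x : Site) : delta m x = if x = m then 1 else 0 := by
  simp only [delta, lp.single_apply, Pi.single_apply]

theorem norm_delta (m : Site) : ‖delta m‖ = 1 := by
  rw [delta, lp.norm_single (by norm_num), norm_one]

theorem linearIndependent_delta : LinearIndependent ℂ delta := by
  rw [linearIndependent_iff']
  intro s g h m hm
  have h1 := congrArg (fun ψ : L2 => ψ m) h
  rw [lp.coeFn_sum, Finset.sum_apply] at h1
  simpa [delta_apply, hm] using h1

theorem op_delta (H : FiniteRangeSchrodinger) (ω : Config) (m γ : Site) :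
    H.op ω (delta m) γ =
      if m - γ ∈ H.B then H.t (m - γ) (translate (-γ) ω) else 0 := by
  rw [H.op_apply, ← Finset.sum_ite_eq' H.B (m - γ) fun η => H.t η (translate (-γ) ω)]
  refine Finset.sum_congr rfl fun η _ => ?_
  rw [delta_apply, mul_ite, mul_one, mul_zero]
  exact if_congr ⟨fun h => by rw [← h]; abel, fun h => by rw [h]; abel⟩ rfl rfl

theorem abs_le_norm_of_mem_spec {A : L2 →L[ℂ] L2} {x : ℝ} (hx : x ∈ spec A) : |x| ≤ ‖A‖ := by
  have hx' : (x : ℂ) ∈ spectrum ℂ A := hx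
  have h := spectrum.norm_le_norm_mul_of_mem hx'
  rw [show ‖(x : ℂ)‖ = |x| from Complex.norm_real x] at h
  exact h.trans (mul_le_of_le_one_right (norm_nonneg _) ContinuousLinearMap.norm_id_le)

/-- Outside the spectrum, an operator is bounded below. -/
theorem exists_norm_le_of_notMem_spec {A : L2 →L[ℂ] L2} {x : ℝ} (hx : x ∉ spec A) :
    ∃ C : ℝ, 0 ≤ C ∧ ∀ ψ, ‖ψ‖ ≤ C * ‖A ψ - (x : ℂ) • ψ‖ := by
  have h : IsUnit (algebraMap ℂ (L2 →L[ℂ] L2) x - A) := by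
    by_contra h
    exact hx h
  obtain ⟨B, hB⟩ := h.exists_left_inv
  refine ⟨‖B‖, norm_nonneg B, fun ψ => ?_⟩
  have h1 : B ((x : ℂ) • ψ - A ψ) = ψ := by
    have := congrArg (fun D : L2 →L[ℂ] L2 => D ψ) hB
    exact this
  calc ‖ψ‖ = ‖B ((x : ℂ) • ψ - A ψ)‖ := by rw [h1]
    _ ≤ ‖B‖ * ‖(x : ℂ) • ψ - A ψ‖ := B.le_opNorm _
    _ = ‖B‖ * ‖A ψ - (x : ℂ) • ψ‖ := by rw [norm_sub_rev]

/-- The orthonormal vectors `delta (f k)` make the eigenspace infinite-dimensional, which excludes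
`x` from the discrete spectrum whether or not it is isolated. -/
theorem mem_essSpec_of_eigenvectors {A : L2 →L[ℂ] L2} {x : ℝ} {f : ℤ → Site}
    (hf : Function.Injective f) (h : ∀ k, A (delta (f k)) = (x : ℂ) • delta (f k)) :
    x ∈ essSpec A := by
  constructor
  · by_contra hx
    obtain ⟨C, -, hC⟩ := exists_norm_le_of_notMem_spec hx
    have := hC (delta (f 0))
    rw [h, sub_self, norm_zero, mul_zero, norm_delta] at this
    linarith
  · rintro ⟨-, -, -, hfin⟩
    let v : ℤ → Module.End.eigenspace (A : Module.End ℂ L2) (x : ℂ) := fun k =>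
      ⟨delta (f k), Module.End.mem_eigenspace_iff.2 (h k)⟩
    have hv : LinearIndependent ℂ v :=
      LinearIndependent.of_comp (Submodule.subtype _) (linearIndependent_delta.comp f hf)
    have := hv.finite
    exact not_finite ℤ

/-! ### Decoupling the illegal sites -/

theorem continuous_quad (m : Site) : Continuous fun ω : Config => quad ω m := by
  unfold quad
  fun_prop

theorem isClopen_illegal (η : Site) : IsClopen {ω : Config | quad ω η ∉ legalQuads} :=
  (isClopen_discrete {q : Quad | q ∉ legalQuads}).preimage (continuous_quad η)

theorem continuous_ite_of_isClopen {p : Config → Prop} [DecidablePred p] (hp : IsClopen {ω | p ω})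
    {f g : Config → ℂ} (hf : Continuous f) (hg : Continuous g) :
    Continuous fun ω => if p ω then f ω else g ω :=
  Continuous.if (by simp [hp.frontier_eq]) hf hg

theorem exists_norm_op_le (H : FiniteRangeSchrodinger) : ∃ C : ℝ, ∀ ω, ‖H.op ω‖ ≤ C := by
  refine ⟨∑ η ∈ H.B.attach, (H.exists_bound η.2).choose, fun ω => ?_⟩
  refine norm_sum_le_of_le _ fun η _ => ?_
  exact LinearMap.mkContinuous_norm_le _
    ((norm_nonneg _).trans ((H.exists_bound η.2).choose_spec ω)) _

/-- The operator obtained from `H` by removing all hopping from and to sites with an illegal patch,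
and by putting the potential `C` there. -/
def decoupled (H : FiniteRangeSchrodinger) (C : ℝ) : FiniteRangeSchrodinger where
  -- The offset 0 is added so that a potential is available even if `H` has no diagonal term.
  B := insert 0 H.B
  neg_mem η hη := by
    rw [Finset.mem_insert] at hη ⊢
    exact hη.imp neg_eq_zero.2 (H.neg_mem η)
  t η ω :=
    if quad ω 0 ∉ legalQuads ∨ quad ω η ∉ legalQuads then if η = 0 then (C : ℂ) else 0
    else if η ∈ H.B then H.t η ω else 0
  continuous_t η _ := by
    refine continuous_ite_of_isClopen
      (p := fun ω => quad ω 0 ∉ legalQuads ∨ quad ω η ∉ legalQuads)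
      ((isClopen_illegal 0).union (isClopen_illegal η)) continuous_const ?_
    by_cases h : η ∈ H.B
    · simpa only [if_pos h] using H.continuous_t η h
    · simpa only [if_neg h] using continuous_const
  symm η _ ω := by
    have hB : -η ∈ H.B ↔ η ∈ H.B := ⟨fun h => neg_neg η ▸ H.neg_mem _ h, H.neg_mem η⟩
    simp only [quad_translate, neg_neg, add_zero, add_neg_cancel, neg_eq_zero, hB]
    simp only [or_comm (a := quad ω η ∉ legalQuads)]
    split_ifs with h1 h2 h3
    · simp
    · simp
    · exact H.symm η h3 ω
    · simp

theorem decoupled_op_eq (H : FiniteRangeSchrodinger) (C : ℝ) {ω : Config}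
    (h : ∀ m, quad ω m ∈ legalQuads) : (decoupled H C).op ω = H.op ω := by
  ext ψ γ
  rw [FiniteRangeSchrodinger.op_apply, FiniteRangeSchrodinger.op_apply]
  symm
  refine Finset.sum_subset_zero_on_sdiff (Finset.subset_insert 0 H.B) (fun η hη => ?_)
    fun η hη => ?_ <;>
  simp only [decoupled, quad_translate, h, not_true_eq_false, or_self, if_false]
  · rw [if_neg (Finset.mem_sdiff.1 hη).2, zero_mul]
  · rw [if_pos hη]

theorem decoupled_op_delta (H : FiniteRangeSchrodinger) (C : ℝ) {ω : Config} {m : Site}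
    (h : quad ω m ∉ legalQuads) : (decoupled H C).op ω (delta m) = (C : ℂ) • delta m := by
  ext γ
  rw [op_delta]
  have h1 : quad (translate (-γ) ω) (m - γ) ∉ legalQuads := by
    rwa [quad_translate, neg_neg, add_sub_cancel]
  rw [lp.coeFn_smul, Pi.smul_apply, delta_apply, smul_eq_mul, mul_ite, mul_one, mul_zero]
  simp only [decoupled, h1, not_false_eq_true, or_true, if_true, sub_eq_zero, Finset.mem_insert]
  by_cases hm : m = γ
  · simp [hm]
  · simp [hm, Ne.symm hm]

/-- With `C` a bound for all `‖H_ω‖`, the value `C + 1` lies outside the spectrum of `H_ω`, but it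
is an eigenvalue of infinite multiplicity once there are infinitely many illegal sites. -/
theorem exists_essSpec_ne (H : FiniteRangeSchrodinger) :
    ∃ H' : FiniteRangeSchrodinger, ∀ (ρ : Config) (f : ℤ → Site), Function.Injective f →
      (∀ k, quad ρ (f k) ∉ legalQuads) → ∀ ω : Config, (∀ m, quad ω m ∈ legalQuads) →
      essSpec (H'.op ρ) ≠ essSpec (H'.op ω) ∧ essSpec (H'.op ω) = essSpec (H.op ω) := by
  obtain ⟨C, hC⟩ := exists_norm_op_le H
  refine ⟨decoupled H (C + 1), fun ρ f hf hρ ω hω => ?_⟩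
  rw [decoupled_op_eq H _ hω]
  refine ⟨fun h => ?_, rfl⟩
  have h1 := mem_essSpec_of_eigenvectors hf fun k => decoupled_op_delta H (C + 1) (hρ k)
  rw [h] at h1
  have h2 := abs_le_norm_of_mem_spec h1.1
  linarith [le_abs_self (C + 1), hC ω]

/-! ### Hopping between the illegal sites -/

/-- The operator with hopping between neighbouring sites with illegal patches. -/
def defectHopping : FiniteRangeSchrodinger where
  B := {(1, 0), (-1, 0), (0, 1), (0, -1)}
  neg_mem := by decide
  t η ω := if quad ω 0 ∉ legalQuads ∧ quad ω η ∉ legalQuads then 1 else 0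
  continuous_t η _ := continuous_ite_of_isClopen
    (p := fun ω => quad ω 0 ∉ legalQuads ∧ quad ω η ∉ legalQuads)
    ((isClopen_illegal 0).inter (isClopen_illegal η)) continuous_const continuous_const
  symm η _ ω := by
    simp only [quad_translate, neg_neg, add_zero, add_neg_cancel]
    simp only [and_comm (a := quad ω η ∉ legalQuads)]
    split_ifs <;> simp

theorem defectHopping_op_eq_zero {ω : Config} (h : ∀ m, quad ω m ∈ legalQuads) :
    defectHopping.op ω = 0 := by
  ext ψ γ
  rw [FiniteRangeSchrodinger.op_apply]
  refine Finset.sum_eq_zero fun η _ => ?_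
  simp [defectHopping, quad_translate, h]

theorem mem_defectHopping_iff {e : Site} (he : e = (1, 0) ∨ e = (0, 1)) (k : ℤ) (γ : Site) :
    k • e - γ ∈ defectHopping.B ∧ (∃ l : ℤ, γ = l • e) ↔ γ = (k + 1) • e ∨ γ = (k - 1) • e := by
  have hB : ∀ η : Site, η ∈ defectHopping.B ↔
      η = (1, 0) ∨ η = (-1, 0) ∨ η = (0, 1) ∨ η = (0, -1) := by
    simp [defectHopping]
  rw [hB]
  constructor
  · rintro ⟨h, l, rfl⟩
    have hl : l = k + 1 ∨ l = k - 1 := by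
      rcases he with rfl | rfl <;> simp at h <;> omega
    exact hl.imp (congrArg (· • e)) (congrArg (· • e))
  · rintro (rfl | rfl) <;> refine ⟨?_, _, rfl⟩ <;> rcases he with rfl | rfl <;> simp

theorem defectHopping_op_delta {ρ : Config} {e : Site} (he : e = (1, 0) ∨ e = (0, 1))
    (h : ∀ m, quad ρ m ∉ legalQuads ↔ ∃ k : ℤ, m = k • e) (k : ℤ) :
    defectHopping.op ρ (delta (k • e)) = delta ((k + 1) • e) + delta ((k - 1) • e) := by
  classical
  ext γ
  have ht : defectHopping.t (k • e - γ) (translate (-γ) ρ) =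
      if ∃ l : ℤ, γ = l • e then 1 else 0 := by
    refine if_congr ?_ rfl rfl
    rw [quad_translate, quad_translate, neg_neg, add_zero, add_sub_cancel, h, h,
      and_iff_left ⟨k, rfl⟩]
  have hne : (k + 1) • e ≠ (k - 1) • e := by
    rcases he with rfl | rfl <;> simp <;> omega
  rw [op_delta, lp.coeFn_add, Pi.add_apply, delta_apply, delta_apply, ht, ← ite_and,
    if_congr (mem_defectHopping_iff he k γ) rfl rfl]
  by_cases h1 : γ = (k + 1) • e
  · rw [if_pos (Or.inl h1), if_pos h1, if_neg (h1 ▸ hne), add_zero]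
  · rw [if_congr (or_iff_right h1) rfl rfl, if_neg h1, zero_add]

/-- A plane wave `z^k` is a generalized eigenvector of the hopping. Cutting it off to `n` sites
leaves only four boundary terms of norm 1, independently of `n`. -/
theorem weyl_bound {A : L2 →L[ℂ] L2} {d : ℤ → L2} (hd : ∀ k, ‖d k‖ = 1)
    (hA : ∀ k, A (d k) = d (k + 1) + d (k - 1)) {z : ℂ} (hz : ‖z‖ = 1) (n : ℕ) :
    ‖A (∑ k ∈ Finset.range n, z ^ (k : ℤ) • d k) -
      (z + z⁻¹) • ∑ k ∈ Finset.range n, z ^ (k : ℤ) • d k‖ ≤ 4 := by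
  have hz0 : z ≠ 0 := by
    rintro rfl
    simp at hz
  have h1 : A (∑ k ∈ Finset.range n, z ^ (k : ℤ) • d k) -
      (z + z⁻¹) • ∑ k ∈ Finset.range n, z ^ (k : ℤ) • d k =
      (z ^ ((n : ℤ) - 1) • d n - z ^ ((0 : ℤ) - 1) • d 0) -
      (z ^ (n : ℤ) • d (n - 1) - z ^ (0 : ℤ) • d (0 - 1)) := by
    -- The error is the difference of two telescoping sums, one from the hops to the right and one
    -- from the hops to the left.
    have e1 := Finset.sum_range_sub (fun k : ℕ => z ^ ((k : ℤ) - 1) • d k) n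
    have e2 := Finset.sum_range_sub (fun k : ℕ => z ^ (k : ℤ) • d (k - 1)) n
    simp only [Nat.cast_add, Nat.cast_one, Nat.cast_zero] at e1 e2
    rw [← e1, ← e2, map_sum, Finset.smul_sum, ← Finset.sum_sub_distrib, ← Finset.sum_sub_distrib]
    refine Finset.sum_congr rfl fun k _ => ?_
    rw [map_smul, hA, add_sub_cancel_right, zpow_sub_one₀ hz0, zpow_add_one₀ hz0]
    module
  have h2 : ∀ (k l : ℤ), ‖z ^ k • d l‖ = 1 := fun k l => by
    rw [norm_smul, norm_zpow, hz, one_zpow, hd, one_mul]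
  rw [h1]
  refine (norm_sub_le_of_le (norm_sub_le _ _) (norm_sub_le _ _)).trans ?_
  simp only [h2]
  norm_num

theorem norm_sum_delta_ge {f : ℤ → Site} (hf : Function.Injective f) {c : ℤ → ℂ}
    (hc : ∀ k, ‖c k‖ = 1) (n : ℕ) :
    (n : ℝ) ≤ ‖∑ k ∈ Finset.range n, c k • delta (f k)‖ ^ 2 := by
  have h := lp.sum_rpow_le_norm_rpow (p := 2) (by norm_num)
    (∑ k ∈ Finset.range n, c k • delta (f k))
    ((Finset.range n).map ⟨fun k : ℕ => f k, fun a b hab => Int.ofNat_injective (hf hab)⟩)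
  have h2 : (2 : ENNReal).toReal = 2 := by norm_num
  rw [Finset.sum_map, h2, Real.rpow_two] at h
  refine le_trans ?_ h
  have h3 : ∀ k ∈ Finset.range n,
      ‖(∑ l ∈ Finset.range n, c l • delta (f l) : L2) (f k)‖ ^ (2 : ℝ) = 1 := by
    intro k hk
    have : (∑ l ∈ Finset.range n, c l • delta (f l) : L2) (f k) = c k := by
      rw [lp.coeFn_sum, Finset.sum_apply]
      simp only [lp.coeFn_smul, Pi.smul_apply, delta_apply, hf.eq_iff, Nat.cast_inj, smul_eq_mul,
        mul_ite, mul_one, mul_zero]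
      rw [Finset.sum_ite_eq, if_pos hk]
    rw [this, hc, Real.one_rpow]
  exact ((Finset.sum_congr rfl h3).trans (by simp)).ge

/-- Weyl's criterion: for `x = 2 cos θ`, truncated plane waves have norm at least `√n` but error at
most 4, so `A - x` is not bounded below. -/
theorem Icc_subset_spec {A : L2 →L[ℂ] L2} {f : ℤ → Site} (hf : Function.Injective f)
    (hA : ∀ k, A (delta (f k)) = delta (f (k + 1)) + delta (f (k - 1))) :
    Set.Icc (-2) 2 ⊆ spec A := by
  rintro x ⟨hx1, hx2⟩
  by_contra hx
  obtain ⟨C, hC0, hC⟩ := exists_norm_le_of_notMem_spec hx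
  set z : ℂ := Complex.exp (Real.arccos (x / 2) * Complex.I) with hz
  have hz1 : ‖z‖ = 1 := Complex.norm_exp_ofReal_mul_I _
  have hzx : z + z⁻¹ = x := by
    rw [hz, ← Complex.exp_neg, ← neg_mul, ← Complex.two_cos, ← Complex.ofReal_cos,
      Real.cos_arccos (by linarith) (by linarith)]
    push_cast
    ring
  obtain ⟨n, hn⟩ := exists_nat_gt ((C * 4) ^ 2)
  have h1 := hC (∑ k ∈ Finset.range n, z ^ (k : ℤ) • delta (f k))
  have h2 := weyl_bound (fun k => norm_delta (f k)) hA hz1 n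
  rw [hzx] at h2
  have h3 := norm_sum_delta_ge hf (c := fun k => z ^ k)
    (fun k => by rw [norm_zpow, hz1, one_zpow]) n
  have h4 := h1.trans (mul_le_mul_of_nonneg_left h2 hC0)
  have h5 := pow_le_pow_left₀ (norm_nonneg _) h4 2
  exact absurd (hn.trans_le (h3.trans h5)) (lt_irrefl _)

theorem volume_spec_sdiff_pos {ρ ω : Config} {e : Site} (he : e = (1, 0) ∨ e = (0, 1))
    (hρ : ∀ m, quad ρ m ∉ legalQuads ↔ ∃ k : ℤ, m = k • e) (hω : ∀ m, quad ω m ∈ legalQuads) :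
    0 < volume (spec (defectHopping.op ρ) \ spec (defectHopping.op ω)) := by
  have he0 : e ≠ 0 := by
    rcases he with rfl | rfl <;> decide
  have hf : Function.Injective fun k : ℤ => k • e := smul_left_injective ℤ he0
  have h1 := Icc_subset_spec hf (defectHopping_op_delta he hρ)
  -- On `Ω(S)` the operator is zero, so its spectrum contains no positive number.
  have h2 : Set.Ioo 0 2 ⊆ spec (defectHopping.op ρ) \ spec (defectHopping.op ω) := by
    rintro x ⟨hx1, hx2⟩
    refine ⟨h1 ⟨by linarith, hx2.le⟩, fun hx => ?_⟩
    have h3 := abs_le_norm_of_mem_spec hx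
    rw [defectHopping_op_eq_zero hω, norm_zero] at h3
    linarith [le_abs_self x]
  refine lt_of_lt_of_le ?_ (measure_mono h2)
  rw [Real.volume_Ioo]
  norm_num

end TableTiling

end

theorem corollary2p7 (a : TableTiling.Letter) :
    ∃ (Ω : Fin 2 → Set TableTiling.Config) (ρ : Fin 2 → TableTiling.Config),
      (∀ j : Fin 2,
        TableTiling.IsSubshift (Ω j) ∧
        ρ j ∈ Ω j ∧
        TableTiling.TendstoSubshift
          (fun n : ℕ => TableTiling.iterSubshift a (2 * n + (j : ℕ))) (Ω j) ∧
        Ω j = TableTiling.orbitClosure (ρ j) ∧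
        TableTiling.subst (TableTiling.subst (ρ j)) = ρ j ∧
        TableTiling.HasPureLineDefect TableTiling.substSubshift (ρ j)) ∧
      (∀ H : TableTiling.FiniteRangeSchrodinger,
        ∃ H' : TableTiling.FiniteRangeSchrodinger,
          ∀ j : Fin 2, ∀ ω ∈ TableTiling.substSubshift,
            TableTiling.essSpec (H'.op (ρ j)) ≠ TableTiling.essSpec (H'.op ω) ∧
            TableTiling.essSpec (H'.op ω) = TableTiling.essSpec (H.op ω)) ∧
      (∃ H' : TableTiling.FiniteRangeSchrodinger,
        ∀ j : Fin 2, ∀ ω ∈ TableTiling.substSubshift,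
          0 < MeasureTheory.volume
            (TableTiling.spec (H'.op (ρ j)) \ TableTiling.spec (H'.op ω))) := by
  open TableTiling in
  refine ⟨fun j => orbitClosure (limitConfig a j), fun j => limitConfig a j, fun j =>
    ⟨isSubshift_orbitClosure _, mem_orbitClosure_self _, tendstoSubshift_limitConfig a j, rfl,
      subst_subst_limitConfig a j, hasPureLineDefect_limitConfig a j⟩, fun H => ?_,
    defectHopping, fun j ω hω => ?_⟩
  · obtain ⟨H', hH'⟩ := exists_essSpec_ne H
    refine ⟨H', fun j ω hω => ?_⟩
    obtain ⟨e, he, h⟩ := exists_axis a j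
    have he0 : e ≠ 0 := by
      rcases he with rfl | rfl <;> decide
    exact hH' _ (fun k => k • e) (smul_left_injective ℤ he0) (fun k => (h _).2 ⟨k, rfl⟩) ω
      (quad_legal_of_mem_substSubshift hω)
  · obtain ⟨e, he, h⟩ := exists_axis a j
    exact volume_spec_sdiff_pos he h (quad_legal_of_mem_substSubshift hω)
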